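/- Let $H$ be a real Hilbert space. For $n\ge 1$ let $H^{\otimes n}$ be the Hilbert space tensor power, i.e. the completion of the algebraic tensor power with respect to the inner product determined by $\langle g_1\otimes\cdots\otimes g_n,\,h_1\otimes\cdots\otimes h_n\rangle=\prod_{i=1}^n\langle g_i,h_i\rangle$. The symmetric group $\mathfrak S_n$ acts on $H^{\otimes n}$ by permuting the components. For $\mathbf a\subseteq\{1,\dots,n\}$ let $H^{\odot\mathbf a,\wedge\mathbf a^c}$ be the subspace of all $t\in H^{\otimes n}$ that are symmetric in the components in $\mathbf a$ ($\sigma t=t$ for every permutation $\sigma$ fixing $\mathbf a^c$ pointwise) and skew-symmetric in the remaining components ($\sigma t=\operatorname{sgn}(\sigma)\,t$ for every $\sigma$ fixing $\mathbf a$ pointwise). For integers $k,q$ with $k+q=n$ let $H^{\odot[k],\wedge[q]}\subseteq H^{\otimes n}$ be the closed linear span of the union of all $H^{\odot\mathbf a,\wedge\mathbf a^c}$ with $|\mathbf a|=k$; it is $\{0\}$ if $k<0$ or $q<0$. Let $k,q\ge 0$ be integers, not both zero, and let $n=k+q$. Then, inside $H^{\otimes n}$, $$H^{\odot[k],\wedge[q]}=\bigl(H^{\odot[k],\wedge[q]}\cap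 H^{\odot[k+1],\wedge[q-1]}\bigr)\oplus\bigl(H^{\odot[k],\wedge[q]}\cap H^{\odot[k-1],\wedge[q+1]}\bigr),$$ that is, the two subspaces on the right intersect only in $0$ and their algebraic sum is the left-hand side. -/

import Mathlib

noncomputable section

/-- The algebraic `n`-fold tensor power of a real vector space `H`. It is a separate type, so that
it carries the Hilbert space cross norm and not the projective seminorm of `PiTensorProduct`. -/
def AlgTensorPower (H : Type*) [NormedAddCommGroup H] [InnerProductSpace ℝ H] (n : ℕ) : Type _ :=
  PiTensorProduct ℝ (fun _ : Fin n => H)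

namespace AlgTensorPower

variable {H : Type*} [NormedAddCommGroup H] [InnerProductSpace ℝ H] {n : ℕ}

instance : AddCommGroup (AlgTensorPower H n) :=
  inferInstanceAs (AddCommGroup (PiTensorProduct ℝ (fun _ : Fin n => H)))

instance : Module ℝ (AlgTensorPower H n) :=
  inferInstanceAs (Module ℝ (PiTensorProduct ℝ (fun _ : Fin n => H)))

/-- The pure tensor `h 0 ⊗ ⋯ ⊗ h (n - 1)`. -/
def pure (h : Fin n → H) : AlgTensorPower H n := PiTensorProduct.tprod ℝ h

/-- The bilinear form with `⟨g₁ ⊗ ⋯ ⊗ gₙ, h₁ ⊗ ⋯ ⊗ hₙ⟩ = ∏ i, ⟨gᵢ, hᵢ⟩`. -/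
def form (H : Type*) [NormedAddCommGroup H] [InnerProductSpace ℝ H] (n : ℕ) :
    PiTensorProduct ℝ (fun _ : Fin n => H) →ₗ[ℝ]
      PiTensorProduct ℝ (fun _ : Fin n => H) →ₗ[ℝ] ℝ :=
  PiTensorProduct.dualDistrib ∘ₗ PiTensorProduct.map (fun _ => innerₗ H)

theorem form_tprod (g h : Fin n → H) :
    form H n (PiTensorProduct.tprod ℝ g) (PiTensorProduct.tprod ℝ h) =
      ∏ i, inner ℝ (g i) (h i) := by
  simp only [form, LinearMap.comp_apply, PiTensorProduct.map_tprod]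
  erw [PiTensorProduct.dualDistrib_apply]
  simp

theorem form_symm (x y : PiTensorProduct ℝ (fun _ : Fin n => H)) :
    form H n x y = form H n y x := by
  have h : form H n = (form H n).flip := by
    refine PiTensorProduct.ext (MultilinearMap.ext fun g => ?_)
    refine PiTensorProduct.ext (MultilinearMap.ext fun h => ?_)
    simp only [LinearMap.compMultilinearMap_apply, LinearMap.flip_apply, form_tprod]
    exact Finset.prod_congr rfl fun i _ => real_inner_comm _ _
  exact congrArg (fun f => f x y) h

theorem exists_mem_range (x : PiTensorProduct ℝ (fun _ : Fin n => H)) :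
    ∃ V : Submodule ℝ H, FiniteDimensional ℝ V ∧
      x ∈ LinearMap.range (PiTensorProduct.map (fun _ : Fin n => V.subtype)) := by
  have mono : ∀ V W : Submodule ℝ H, V ≤ W →
      LinearMap.range (PiTensorProduct.map (fun _ : Fin n => V.subtype)) ≤
        LinearMap.range (PiTensorProduct.map (fun _ : Fin n => W.subtype)) := by
    intro V W hVW
    have : PiTensorProduct.map (fun _ : Fin n => V.subtype) =
        PiTensorProduct.map (fun _ : Fin n => W.subtype) ∘ₗ
          PiTensorProduct.map (fun _ : Fin n => Submodule.inclusion hVW) := by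
      rw [← PiTensorProduct.map_comp]
      rfl
    rw [this]
    exact LinearMap.range_comp_le_range _ _
  induction x using PiTensorProduct.induction_on with
  | smul_tprod r f =>
    refine ⟨Submodule.span ℝ (Set.range f),
      FiniteDimensional.span_of_finite ℝ (Set.finite_range f), Submodule.smul_mem _ _ ?_⟩
    refine ⟨PiTensorProduct.tprod ℝ
      (fun i => ⟨f i, Submodule.subset_span (Set.mem_range_self i)⟩), ?_⟩
    rw [PiTensorProduct.map_tprod]
    rfl
  | add x y hx hy =>
    obtain ⟨V, hV, hxV⟩ := hx
    obtain ⟨W, hW, hyW⟩ := hy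
    exact ⟨V ⊔ W, inferInstance,
      Submodule.add_mem _ (mono _ _ le_sup_left hxV) (mono _ _ le_sup_right hyW)⟩

theorem form_self (x : PiTensorProduct ℝ (fun _ : Fin n => H)) :
    0 ≤ form H n x x ∧ (form H n x x = 0 → x = 0) := by
  obtain ⟨V, hV, y, rfl⟩ := exists_mem_range x
  let e := stdOrthonormalBasis ℝ V
  let b := Basis.piTensorProduct (fun _ : Fin n => e.toBasis)
  have key : ∀ p q, form H n (PiTensorProduct.map (fun _ : Fin n => V.subtype) (b p))
      (PiTensorProduct.map (fun _ : Fin n => V.subtype) (b q)) = if p = q then 1 else 0 := by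
    intro p q
    simp only [b, Basis.piTensorProduct_apply, PiTensorProduct.map_tprod, form_tprod]
    have : ∀ i, inner ℝ (V.subtype (e.toBasis (p i))) (V.subtype (e.toBasis (q i))) =
        if p i = q i then (1 : ℝ) else 0 := by
      intro i
      have := orthonormal_iff_ite.mp e.orthonormal (p i) (q i)
      simpa using this
    simp only [this, Fintype.prod_ite_zero, ← funext_iff, Finset.prod_const_one]
  have hsum : form H n (PiTensorProduct.map (fun _ : Fin n => V.subtype) y)
      (PiTensorProduct.map (fun _ : Fin n => V.subtype) y) = ∑ p, b.repr y p ^ 2 := by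
    conv_lhs => rw [← b.sum_repr y]
    simp only [map_sum, map_smul, LinearMap.sum_apply, LinearMap.smul_apply, key, smul_eq_mul]
    refine Finset.sum_congr rfl fun p _ => ?_
    simp [sq]
  rw [hsum]
  refine ⟨Finset.sum_nonneg fun p _ => sq_nonneg _, fun h => ?_⟩
  have h0 : y = 0 := by
    refine b.ext_elem fun p => ?_
    have := (Finset.sum_eq_zero_iff_of_nonneg (fun p _ => sq_nonneg (b.repr y p))).mp h p
      (Finset.mem_univ p)
    simpa using this
  rw [h0, map_zero]

/-- The inner product on the algebraic tensor power. -/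
@[reducible]
def innerCore : InnerProductSpace.Core ℝ (AlgTensorPower H n) where
  inner x y := form H n x y
  conj_inner_symm x y := form_symm (H := H) (n := n) y x
  re_inner_nonneg x := (form_self (H := H) (n := n) x).1
  add_left x y z := LinearMap.map_add₂ (form H n) x y z
  smul_left x y r := LinearMap.map_smul₂ (form H n) r x y
  definite x h := (form_self (H := H) (n := n) x).2 h

instance : NormedAddCommGroup (AlgTensorPower H n) :=
  InnerProductSpace.Core.toNormedAddCommGroup (cd := innerCore)

instance : InnerProductSpace ℝ (AlgTensorPower H n) :=
  InnerProductSpace.ofCore innerCore.toCore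

theorem inner_pure (g h : Fin n → H) :
    inner ℝ (pure g) (pure h) = ∏ i, inner ℝ (g i) (h i) :=
  form_tprod g h

/-- The action of `σ` on the algebraic tensor power: it moves the component in position `i` to
position `σ i`. -/
def perm (σ : Equiv.Perm (Fin n)) : AlgTensorPower H n →ₗᵢ[ℝ] AlgTensorPower H n :=
  LinearMap.isometryOfInner
    (show AlgTensorPower H n →ₗ[ℝ] AlgTensorPower H n from
      (PiTensorProduct.reindex ℝ (fun _ : Fin n => H) σ).toLinearMap) <| by
    have h : (form H n).compl₁₂
        (PiTensorProduct.reindex ℝ (fun _ : Fin n => H) σ).toLinearMap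
        (PiTensorProduct.reindex ℝ (fun _ : Fin n => H) σ).toLinearMap = form H n := by
      refine PiTensorProduct.ext (MultilinearMap.ext fun g => ?_)
      refine PiTensorProduct.ext (MultilinearMap.ext fun h => ?_)
      simp only [LinearMap.compMultilinearMap_apply, LinearMap.compl₁₂_apply,
        LinearEquiv.coe_coe, PiTensorProduct.reindex_tprod, form_tprod]
      exact Equiv.prod_comp σ.symm (fun i => inner ℝ (g i) (h i))
    intro x y
    exact congrArg (fun f => f x y) h

theorem perm_pure (σ : Equiv.Perm (Fin n)) (h : Fin n → H) :
    perm σ (pure h) = pure (fun i => h (σ.symm i)) :=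
  PiTensorProduct.reindex_tprod σ h

end AlgTensorPower

/-- The Hilbert space tensor power `H^{⊗n}`: the completion of the algebraic tensor power for the
inner product with `⟨g₁ ⊗ ⋯ ⊗ gₙ, h₁ ⊗ ⋯ ⊗ hₙ⟩ = ∏ i, ⟨gᵢ, hᵢ⟩`. -/
abbrev HilbertTensorPower (H : Type*) [NormedAddCommGroup H] [InnerProductSpace ℝ H] (n : ℕ) :
    Type _ :=
  UniformSpace.Completion (AlgTensorPower H n)

namespace HilbertTensorPower

variable {H : Type*} [NormedAddCommGroup H] [InnerProductSpace ℝ H] {n : ℕ}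

/-- The action of the symmetric group on `H^{⊗n}` by permuting the components, extended by
continuity from the algebraic tensor power. -/
def perm (σ : Equiv.Perm (Fin n)) : HilbertTensorPower H n →L[ℝ] HilbertTensorPower H n :=
  (AlgTensorPower.perm σ).toContinuousLinearMap.completion

theorem perm_pure (σ : Equiv.Perm (Fin n)) (h : Fin n → H) :
    perm σ (AlgTensorPower.pure h : HilbertTensorPower H n) =
      (AlgTensorPower.pure (fun i => h (σ.symm i)) : HilbertTensorPower H n) := by
  rw [← AlgTensorPower.perm_pure]
  exact ContinuousLinearMap.completion_apply_coe _ _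

/-- `H^{⊙a, ∧aᶜ}`: the tensors that are symmetric in the components with position in `a` and
skew-symmetric in the remaining components. -/
def symSkew (H : Type*) [NormedAddCommGroup H] [InnerProductSpace ℝ H] {n : ℕ}
    (a : Finset (Fin n)) : Submodule ℝ (HilbertTensorPower H n) where
  carrier := {t |
    (∀ σ : Equiv.Perm (Fin n), (∀ i ∉ a, σ i = i) → perm σ t = t) ∧
    (∀ σ : Equiv.Perm (Fin n), (∀ i ∈ a, σ i = i) →
      perm σ t = ((Equiv.Perm.sign σ : ℤ) : ℝ) • t)}
  zero_mem' := by simp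
  add_mem' := by
    rintro s t ⟨hs, hs'⟩ ⟨ht, ht'⟩
    refine ⟨fun σ h => ?_, fun σ h => ?_⟩
    · rw [map_add, hs σ h, ht σ h]
    · rw [map_add, hs' σ h, ht' σ h, smul_add]
  smul_mem' := by
    rintro c t ⟨ht, ht'⟩
    refine ⟨fun σ h => ?_, fun σ h => ?_⟩
    · rw [map_smul, ht σ h]
    · rw [map_smul, ht' σ h, smul_comm]

/-- `H^{⊙[k], ∧[q]}` inside `H^{⊗n}`: the closed linear span of the tensors that are symmetric in
any `k` components and skew-symmetric in the remaining `q` components. The parameters are integers,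
so that `k - 1` and `q - 1` have their usual meaning; if one of `k`, `q` is negative (or if
`k + q ≠ n`), there is no such choice of components and the space is zero. -/
def symSkewSpan (H : Type*) [NormedAddCommGroup H] [InnerProductSpace ℝ H] (n : ℕ) (k q : ℤ) :
    Submodule ℝ (HilbertTensorPower H n) :=
  (Submodule.span ℝ {t | ∃ a : Finset (Fin n),
    (a.card : ℤ) = k ∧ (aᶜ.card : ℤ) = q ∧ t ∈ symSkew H a}).topologicalClosure

end HilbertTensorPower

end

namespace HilbertTensorPower

variable {H : Type*} [NormedAddCommGroup H] [InnerProductSpace ℝ H] {n : ℕ}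

/-! Let `T` be the sum of all transpositions (`swapSum`), an operator that does not depend on `a`.
On `symSkew H a` with `|a| = k`, `|aᶜ| = q`, it is `k² - q² + 2q + 2C`, where `C` sums the swaps
between `a` and `aᶜ`. Symmetrizing over one more position and summing over that position gives `q +
C`, so `T - (k² - q²)` raises `k` by one; skew-symmetrizing gives `k - C`, so `T - (k² - q² + 2(k +
q))` lowers it by one. Both operators also preserve `symSkewSpan H n k q`, and their difference is
the nonzero scalar `2(k + q)`, which decomposes every vector, with no closure needed for the sum.
The summands are orthogonal because their numbers of symmetric positions differ by two. -/

theorem perm_coe (σ : Equiv.Perm (Fin n)) (x : AlgTensorPower H n) :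
    perm σ (x : HilbertTensorPower H n) = (AlgTensorPower.perm σ x : AlgTensorPower H n) :=
  ContinuousLinearMap.completion_apply_coe _ _

theorem perm_mul_apply (σ τ : Equiv.Perm (Fin n)) (t : HilbertTensorPower H n) :
    perm (σ * τ) t = perm σ (perm τ t) := by
  induction t using UniformSpace.Completion.induction_on with
  | hp => exact isClosed_eq (by fun_prop) (by fun_prop)
  | ih x =>
    simp only [perm_coe]
    congr 1
    have h : (AlgTensorPower.perm (H := H) (σ * τ)).toLinearMap =
        (AlgTensorPower.perm σ).toLinearMap ∘ₗ (AlgTensorPower.perm τ).toLinearMap := by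
      refine PiTensorProduct.ext (MultilinearMap.ext fun h => ?_)
      change AlgTensorPower.perm (σ * τ) (AlgTensorPower.pure h) =
        AlgTensorPower.perm σ (AlgTensorPower.perm τ (AlgTensorPower.pure h))
      simp only [AlgTensorPower.perm_pure]
      rfl
    exact congrArg (fun f => f x) h

theorem inner_perm_perm (σ : Equiv.Perm (Fin n)) (s t : HilbertTensorPower H n) :
    inner ℝ (perm σ s) (perm σ t) = inner ℝ s t := by
  induction s, t using UniformSpace.Completion.induction_on₂ with
  | hp => exact isClosed_eq (by fun_prop) (by fun_prop)
  | ih x y => simp only [perm_coe, UniformSpace.Completion.inner_coe, LinearIsometry.inner_map_map]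

/-- The tensors on which the permutations of the positions in `b` act through the character `χ`. -/
def IsSemiInvariant (χ : Equiv.Perm (Fin n) →* ℤˣ) (b : Finset (Fin n))
    (t : HilbertTensorPower H n) : Prop :=
  ∀ σ : Equiv.Perm (Fin n), (∀ i ∉ b, σ i = i) → perm σ t = ((χ σ : ℤ) : ℝ) • t

theorem mem_symSkew_iff {a : Finset (Fin n)} {t : HilbertTensorPower H n} :
    t ∈ symSkew H a ↔ IsSemiInvariant 1 a t ∧ IsSemiInvariant Equiv.Perm.sign aᶜ t := by
  simp [symSkew, IsSemiInvariant]

namespace IsSemiInvariant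

variable {χ ψ : Equiv.Perm (Fin n) →* ℤˣ} {b c : Finset (Fin n)} {t : HilbertTensorPower H n}

/-- The sum over coset representatives extending semi-invariance from `b` to `insert j b`. -/
noncomputable def extend (χ : Equiv.Perm (Fin n) →* ℤˣ) (b : Finset (Fin n)) (j : Fin n)
    (t : HilbertTensorPower H n) : HilbertTensorPower H n :=
  ∑ i ∈ insert j b, ((χ (Equiv.swap i j) : ℤ) : ℝ) • perm (Equiv.swap i j) t

/-- Left multiplication by `σ` permutes the cosets represented by the swaps, up to factors supported
on `b`, which act on `t` through `χ`. -/
theorem extend_insert (ht : IsSemiInvariant χ b t) (j : Fin n) :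
    IsSemiInvariant χ (insert j b) (extend χ b j t) := by
  intro σ hσ
  have mem_iff : ∀ i, i ∈ insert j b ↔ σ i ∈ insert j b := by
    refine fun i => ⟨fun hi => ?_, fun hi => ?_⟩
    · by_contra h
      rw [σ.injective (hσ _ h)] at h
      exact h hi
    · by_contra h
      rw [hσ _ h] at hi
      exact h hi
  simp only [extend, map_sum, map_smul, Finset.smul_sum]
  refine Finset.sum_equiv σ mem_iff fun i hi => ?_
  -- The swaps are chosen so that `ρ` sends `j` to `i`, to `σ i`, and back to `j`.
  set ρ : Equiv.Perm (Fin n) := Equiv.swap (σ i) j * σ * Equiv.swap i j with hρ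
  have hσρ : σ * Equiv.swap i j = Equiv.swap (σ i) j * ρ := by
    rw [hρ, mul_assoc, ← mul_assoc, Equiv.swap_mul_self, one_mul]
  have hfix : ∀ l ∉ b, ρ l = l := by
    intro l hl
    by_cases hlj : l = j
    · simp [hρ, hlj]
    · have hl' : l ∉ insert j b := by simp [hlj, hl]
      have hli : l ≠ i := fun h => hl' (h ▸ hi)
      have hlσ : l ≠ σ i := fun h => hl' (h ▸ (mem_iff i).mp hi)
      simp [hρ, Equiv.swap_apply_of_ne_of_ne hli hlj, hσ l hl',
        Equiv.swap_apply_of_ne_of_ne hlσ hlj]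
  rw [← perm_mul_apply, hσρ, perm_mul_apply, ht ρ hfix, map_smul, smul_smul, smul_smul]
  congr 1
  rw [← Int.cast_mul, ← Int.cast_mul, ← Units.val_mul, ← Units.val_mul, hρ, map_mul, map_mul]
  congr 2
  calc χ (Equiv.swap i j) * (χ (Equiv.swap (σ i) j) * χ σ * χ (Equiv.swap i j))
      = χ (Equiv.swap i j) * χ (Equiv.swap i j) * (χ σ * χ (Equiv.swap (σ i) j)) := by
        simp only [mul_comm, mul_left_comm]
    _ = _ := by rw [← map_mul, Equiv.swap_mul_self, map_one, one_mul]

theorem extend_of_disjoint (ht : IsSemiInvariant ψ c t) {j : Fin n}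
    (h : Disjoint c (insert j b)) : IsSemiInvariant ψ c (extend χ b j t) := by
  intro σ hσ
  have hσ' : ∀ i ∈ insert j b, σ i = i := fun i hi => hσ i (Finset.disjoint_right.mp h hi)
  simp only [extend, map_sum, map_smul, Finset.smul_sum]
  refine Finset.sum_congr rfl fun i hi => ?_
  have hcomm : σ * Equiv.swap i j = Equiv.swap i j * σ := by
    rw [Equiv.mul_swap_eq_swap_mul, hσ' i hi, hσ' j (Finset.mem_insert_self j b)]
  rw [← perm_mul_apply, hcomm, perm_mul_apply, ht σ hσ, map_smul, smul_comm]

theorem mono (ht : IsSemiInvariant χ b t) (h : c ⊆ b) : IsSemiInvariant χ c t :=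
  fun σ hσ => ht σ fun i hi => hσ i fun hc => hi (h hc)

theorem perm_swap (ht : IsSemiInvariant χ b t) {i j : Fin n} (hi : i ∈ b) (hj : j ∈ b) :
    perm (Equiv.swap i j) t = ((χ (Equiv.swap i j) : ℤ) : ℝ) • t :=
  ht _ fun _ hl => Equiv.swap_apply_of_ne_of_ne (fun h => hl (h ▸ hi)) fun h => hl (h ▸ hj)

theorem perm_apply (ht : IsSemiInvariant χ b t) (τ : Equiv.Perm (Fin n)) :
    IsSemiInvariant χ (b.map τ.toEmbedding) (perm τ t) := by
  intro σ hσ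
  have hfix : ∀ i ∉ b, (τ⁻¹ * σ * τ) i = i := by
    intro i hi
    have : σ (τ i) = τ i := hσ _ (by simpa using hi)
    simp [this]
  rw [← perm_mul_apply, show σ * τ = τ * (τ⁻¹ * σ * τ) by group, perm_mul_apply, ht _ hfix,
    map_smul]
  congr 3
  rw [map_mul, map_mul, mul_right_comm, ← map_mul, inv_mul_cancel, map_one, one_mul]

end IsSemiInvariant

open IsSemiInvariant

section symSkew

variable {a b : Finset (Fin n)} {t s : HilbertTensorPower H n}

theorem extend_mem_symSkew_insert (ht : t ∈ symSkew H a) (j : Fin n) :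
    extend 1 a j t ∈ symSkew H (insert j a) := by
  rw [mem_symSkew_iff] at ht ⊢
  exact ⟨ht.1.extend_insert j, extend_of_disjoint
    (ht.2.mono (Finset.compl_subset_compl.mpr (Finset.subset_insert j a))) disjoint_compl_left⟩

theorem extend_mem_symSkew_erase (ht : t ∈ symSkew H a) (i : Fin n) :
    extend Equiv.Perm.sign aᶜ i t ∈ symSkew H (a.erase i) := by
  rw [mem_symSkew_iff] at ht ⊢
  rw [Finset.compl_erase]
  refine ⟨extend_of_disjoint (ht.1.mono (Finset.erase_subset i a)) ?_, ht.2.extend_insert i⟩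
  rw [← Finset.compl_erase]
  exact disjoint_compl_right

theorem perm_mem_symSkew (ht : t ∈ symSkew H a) (τ : Equiv.Perm (Fin n)) :
    perm τ t ∈ symSkew H (a.map τ.toEmbedding) := by
  rw [mem_symSkew_iff] at ht ⊢
  refine ⟨ht.1.perm_apply τ, ?_⟩
  convert ht.2.perm_apply τ using 1
  ext i
  simp

/-- Two positions lie in `b \ a`; swapping them is an isometry that negates `t` and fixes `s`. -/
theorem inner_eq_zero_of_mem_symSkew (ht : t ∈ symSkew H a) (hs : s ∈ symSkew H b)
    (h : a.card + 2 ≤ b.card) : inner ℝ t s = 0 := by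
  rw [mem_symSkew_iff] at ht hs
  have hcard : 1 < (b \ a).card := by
    have := Finset.le_card_sdiff a b
    omega
  obtain ⟨i, hi, j, hj, hij⟩ := Finset.one_lt_card.mp hcard
  rw [Finset.mem_sdiff] at hi hj
  have h1 := inner_perm_perm (Equiv.swap i j) t s
  rw [ht.2.perm_swap (Finset.mem_compl.mpr hi.2) (Finset.mem_compl.mpr hj.2),
    hs.1.perm_swap hi.1 hj.1, Equiv.Perm.sign_swap hij] at h1
  simp [inner_neg_left] at h1
  linarith

end symSkew

/-! ### The sum of all transpositions -/

/-- The sum of the actions of `swap i j` over all ordered pairs `(i, j)`, diagonal included. -/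
noncomputable def swapSum (H : Type*) [NormedAddCommGroup H] [InnerProductSpace ℝ H] (n : ℕ) :
    HilbertTensorPower H n →L[ℝ] HilbertTensorPower H n :=
  ∑ i, ∑ j, perm (Equiv.swap i j)

theorem swapSum_apply (t : HilbertTensorPower H n) :
    swapSum H n t = ∑ i, ∑ j, perm (Equiv.swap i j) t := by
  simp [swapSum]

section swapSum

variable {a : Finset (Fin n)} {t : HilbertTensorPower H n}

theorem perm_one_apply (t : HilbertTensorPower H n) : perm 1 t = t := by
  induction t using UniformSpace.Completion.induction_on with
  | hp => exact isClosed_eq (by fun_prop) (by fun_prop)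
  | ih x =>
    rw [perm_coe]
    congr 1
    have h : (AlgTensorPower.perm (H := H) (1 : Equiv.Perm (Fin n))).toLinearMap =
        LinearMap.id := by
      refine PiTensorProduct.ext (MultilinearMap.ext fun h => ?_)
      exact AlgTensorPower.perm_pure 1 h
    exact congrArg (fun f => f x) h

theorem sum_extend_one (a : Finset (Fin n)) (t : HilbertTensorPower H n) :
    ∑ j ∈ aᶜ, extend 1 a j t =
      (aᶜ.card : ℝ) • t + ∑ i ∈ a, ∑ j ∈ aᶜ, perm (Equiv.swap i j) t := by
  rw [Finset.sum_comm, Nat.cast_smul_eq_nsmul, ← Finset.sum_const, ← Finset.sum_add_distrib]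
  refine Finset.sum_congr rfl fun j hj => ?_
  rw [extend, Finset.sum_insert (Finset.mem_compl.mp hj), Equiv.swap_self,
    ← Equiv.Perm.one_def, perm_one_apply]
  simp

theorem sum_extend_sign (a : Finset (Fin n)) (t : HilbertTensorPower H n) :
    ∑ i ∈ a, extend Equiv.Perm.sign aᶜ i t =
      (a.card : ℝ) • t - ∑ i ∈ a, ∑ j ∈ aᶜ, perm (Equiv.swap i j) t := by
  rw [Nat.cast_smul_eq_nsmul, ← Finset.sum_const, ← Finset.sum_sub_distrib]
  refine Finset.sum_congr rfl fun i hi => ?_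
  have hi' : i ∉ aᶜ := by simpa using hi
  rw [extend, Finset.sum_insert hi', Equiv.swap_self, ← Equiv.Perm.one_def, perm_one_apply,
    sub_eq_add_neg, ← Finset.sum_neg_distrib, map_one, Units.val_one, Int.cast_one, one_smul]
  congr 1
  refine Finset.sum_congr rfl fun j hj => ?_
  have hji : j ≠ i := ne_of_mem_of_not_mem hj hi'
  rw [Equiv.Perm.sign_swap hji, Equiv.swap_comm]
  simp

/-- Split the pairs into blocks: `a × a` acts by a scalar, `aᶜ × aᶜ` by another, and the two mixed
blocks coincide. -/
theorem swapSum_apply_of_mem_symSkew (ht : t ∈ symSkew H a) :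
    swapSum H n t = ((a.card : ℝ) ^ 2 - (aᶜ.card : ℝ) ^ 2 + 2 * aᶜ.card) • t +
      (2 : ℝ) • ∑ i ∈ a, ∑ j ∈ aᶜ, perm (Equiv.swap i j) t := by
  rw [mem_symSkew_iff] at ht
  have hsym : ∑ i ∈ a, ∑ j ∈ a, perm (Equiv.swap i j) t = ((a.card : ℝ) ^ 2) • t := by
    rw [Finset.sum_congr rfl fun i hi => Finset.sum_congr rfl fun j hj => ht.1.perm_swap hi hj]
    simp only [MonoidHom.one_apply, Units.val_one, Int.cast_one, one_smul, Finset.sum_const,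
      ← Nat.cast_smul_eq_nsmul ℝ, smul_smul, sq]
  have hskew : ∑ i ∈ aᶜ, ∑ j ∈ aᶜ, perm (Equiv.swap i j) t =
      (2 * (aᶜ.card : ℝ) - (aᶜ.card : ℝ) ^ 2) • t := by
    -- The diagonal gives `1` and each of the other `|aᶜ| - 1` swaps gives `-1`.
    have hrow : ∀ i ∈ aᶜ, ∑ j ∈ aᶜ, perm (Equiv.swap i j) t = (2 - (aᶜ.card : ℝ)) • t := by
      intro i hi
      rw [Finset.sum_congr rfl fun j hj => ht.2.perm_swap hi hj, ← Finset.sum_smul]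
      congr 1
      have hsign : ∀ j, ((Equiv.Perm.sign (Equiv.swap i j) : ℤ) : ℝ) =
          (if i = j then 2 else 0) - 1 := by
        intro j
        rw [Equiv.Perm.sign_swap']
        split_ifs <;> norm_num
      simp only [hsign, Finset.sum_sub_distrib, Finset.sum_ite_eq, if_pos hi, Finset.sum_const,
        nsmul_eq_mul, mul_one]
    rw [Finset.sum_congr rfl hrow, Finset.sum_const, ← Nat.cast_smul_eq_nsmul ℝ, smul_smul]
    congr 1
    ring
  have hcross : ∑ i ∈ aᶜ, ∑ j ∈ a, perm (Equiv.swap i j) t =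
      ∑ i ∈ a, ∑ j ∈ aᶜ, perm (Equiv.swap i j) t := by
    rw [Finset.sum_comm]
    simp only [Equiv.swap_comm]
  rw [swapSum_apply]
  simp only [← Finset.sum_add_sum_compl a, Finset.sum_add_distrib]
  rw [hsym, hskew, hcross]
  module

end swapSum

/-! ### Raising, lowering and orthogonality of the closed spans -/

section symSkewSpan

variable {k q : ℤ}

theorem mem_symSkewSpan_of_mem_symSkew {a : Finset (Fin n)} {t : HilbertTensorPower H n}
    (ht : t ∈ symSkew H a) (hk : (a.card : ℤ) = k) (hq : (aᶜ.card : ℤ) = q) :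
    t ∈ symSkewSpan H n k q :=
  Submodule.le_topologicalClosure _ (Submodule.subset_span ⟨a, hk, hq, ht⟩)

theorem map_mem_of_mem_symSkewSpan
    (f : HilbertTensorPower H n →L[ℝ] HilbertTensorPower H n)
    {M : Submodule ℝ (HilbertTensorPower H n)} (hM : IsClosed (M : Set (HilbertTensorPower H n)))
    (h : ∀ a : Finset (Fin n), (a.card : ℤ) = k → (aᶜ.card : ℤ) = q →
      ∀ t ∈ symSkew H a, f t ∈ M)
    {t : HilbertTensorPower H n} (ht : t ∈ symSkewSpan H n k q) : f t ∈ M := by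
  have hle : symSkewSpan H n k q ≤ M.comap f.toLinearMap := by
    refine Submodule.topologicalClosure_minimal _ ?_ (hM.preimage f.continuous)
    rw [Submodule.span_le]
    rintro t ⟨a, hk, hq, ht⟩
    exact h a hk hq t ht
  exact hle ht

theorem isClosed_symSkewSpan : IsClosed (symSkewSpan H n k q : Set (HilbertTensorPower H n)) :=
  Submodule.isClosed_topologicalClosure _

/-- Each permutation carries `symSkew H a` into the space of the image of `a`, which has the same
cardinality. -/
theorem swapSum_mem_symSkewSpan {t : HilbertTensorPower H n} (ht : t ∈ symSkewSpan H n k q) :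
    swapSum H n t ∈ symSkewSpan H n k q := by
  refine map_mem_of_mem_symSkewSpan _ isClosed_symSkewSpan (fun a hk hq t ht => ?_) ht
  rw [swapSum_apply]
  refine Submodule.sum_mem _ fun i _ => Submodule.sum_mem _ fun j _ =>
    mem_symSkewSpan_of_mem_symSkew (perm_mem_symSkew ht _) ?_ ?_
  · simpa using hk
  · rwa [Finset.card_compl, Finset.card_map, ← Finset.card_compl]

theorem swapSum_sub_smul_mem_symSkewSpan_add {t : HilbertTensorPower H n}
    (ht : t ∈ symSkewSpan H n k q) :
    swapSum H n t - ((k : ℝ) ^ 2 - (q : ℝ) ^ 2) • t ∈ symSkewSpan H n (k + 1) (q - 1) := by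
  refine map_mem_of_mem_symSkewSpan
    (swapSum H n - ((k : ℝ) ^ 2 - (q : ℝ) ^ 2) • ContinuousLinearMap.id ℝ _)
    isClosed_symSkewSpan (fun a hk hq t ht => ?_) ht
  -- The scalar is chosen to leave `2(q + C)`.
  have h : swapSum H n t - ((k : ℝ) ^ 2 - (q : ℝ) ^ 2) • t =
      (2 : ℝ) • ∑ j ∈ aᶜ, extend 1 a j t := by
    rw [sum_extend_one, swapSum_apply_of_mem_symSkew ht, ← hk, ← hq]
    push_cast
    module
  change swapSum H n t - ((k : ℝ) ^ 2 - (q : ℝ) ^ 2) • t ∈ _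
  rw [h]
  refine Submodule.smul_mem _ _ (Submodule.sum_mem _ fun j hj => ?_)
  rw [Finset.mem_compl] at hj
  have hcard := Finset.card_insert_of_notMem hj
  have h1 := Finset.card_add_card_compl a
  have h2 := Finset.card_add_card_compl (insert j a)
  exact mem_symSkewSpan_of_mem_symSkew (extend_mem_symSkew_insert ht j) (by omega) (by omega)

theorem swapSum_sub_smul_mem_symSkewSpan_sub {t : HilbertTensorPower H n}
    (ht : t ∈ symSkewSpan H n k q) :
    swapSum H n t - ((k : ℝ) ^ 2 - (q : ℝ) ^ 2 + 2 * (k + q)) • t ∈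
      symSkewSpan H n (k - 1) (q + 1) := by
  refine map_mem_of_mem_symSkewSpan
    (swapSum H n - ((k : ℝ) ^ 2 - (q : ℝ) ^ 2 + 2 * (k + q)) • ContinuousLinearMap.id ℝ _)
    isClosed_symSkewSpan (fun a hk hq t ht => ?_) ht
  -- Here the scalar leaves `-2(k - C)`. For `k = 0` the sum is empty, matching the zero target
  -- space.
  have h : swapSum H n t - ((k : ℝ) ^ 2 - (q : ℝ) ^ 2 + 2 * (k + q)) • t =
      (-2 : ℝ) • ∑ i ∈ a, extend Equiv.Perm.sign aᶜ i t := by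
    rw [sum_extend_sign, swapSum_apply_of_mem_symSkew ht, ← hk, ← hq]
    push_cast
    module
  change swapSum H n t - ((k : ℝ) ^ 2 - (q : ℝ) ^ 2 + 2 * (k + q)) • t ∈ _
  rw [h]
  refine Submodule.smul_mem _ _ (Submodule.sum_mem _ fun i hi => ?_)
  have hcard := Finset.card_erase_add_one hi
  have h1 := Finset.card_add_card_compl a
  have h2 := Finset.card_add_card_compl (a.erase i)
  exact mem_symSkewSpan_of_mem_symSkew (extend_mem_symSkew_erase ht i) (by omega) (by omega)

theorem isOrtho_symSkewSpan {k' q' : ℤ} (h : k' + 2 ≤ k) :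
    symSkewSpan H n k q ⟂ symSkewSpan H n k' q' := by
  refine Submodule.topologicalClosure_minimal _ ?_ (Submodule.isClosed_orthogonal _)
  rw [symSkewSpan, Submodule.orthogonal_closure]
  refine Submodule.isOrtho_span.mpr ?_
  rintro s ⟨b, hb, -, hs⟩ t ⟨a, ha, -, ht⟩
  rw [real_inner_comm]
  exact inner_eq_zero_of_mem_symSkew ht hs (by omega)

end symSkewSpan

end HilbertTensorPower

theorem mainTheorem4 (H : Type*) [NormedAddCommGroup H] [InnerProductSpace ℝ H] [CompleteSpace H]
    (k q : ℕ) (hkq : 1 ≤ k + q) :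
    Disjoint
      (HilbertTensorPower.symSkewSpan H (k + q) k q ⊓
        HilbertTensorPower.symSkewSpan H (k + q) (k + 1) (q - 1))
      (HilbertTensorPower.symSkewSpan H (k + q) k q ⊓
        HilbertTensorPower.symSkewSpan H (k + q) (k - 1) (q + 1)) ∧
    HilbertTensorPower.symSkewSpan H (k + q) k q =
      (HilbertTensorPower.symSkewSpan H (k + q) k q ⊓
        HilbertTensorPower.symSkewSpan H (k + q) (k + 1) (q - 1)) ⊔
      (HilbertTensorPower.symSkewSpan H (k + q) k q ⊓
        HilbertTensorPower.symSkewSpan H (k + q) (k - 1) (q + 1)) := by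
  refine ⟨(HilbertTensorPower.isOrtho_symSkewSpan (by omega)).disjoint.mono inf_le_right inf_le_right,
    le_antisymm (fun t ht => ?_) (sup_le inf_le_left inf_le_left)⟩
  have hadd := HilbertTensorPower.swapSum_sub_smul_mem_symSkewSpan_add ht
  have hsub := HilbertTensorPower.swapSum_sub_smul_mem_symSkewSpan_sub ht
  have hT := HilbertTensorPower.swapSum_mem_symSkewSpan ht
  have hpos : (2 * ((k : ℝ) + q)) ≠ 0 := by
    have : (1 : ℝ) ≤ k + q := by exact_mod_cast hkq
    positivity
  rw [Submodule.mem_sup]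
  -- Subtracting the two shifted operators cancels `T` and leaves `2(k + q) • t`.
  refine ⟨(2 * ((k : ℝ) + q))⁻¹ • _,
    Submodule.smul_mem _ _ ⟨Submodule.sub_mem _ hT (Submodule.smul_mem _ _ ht), hadd⟩,
    -(2 * ((k : ℝ) + q))⁻¹ • _,
    Submodule.smul_mem _ _ ⟨Submodule.sub_mem _ hT (Submodule.smul_mem _ _ ht), hsub⟩, ?_⟩
  push_cast
  rw [neg_smul, ← sub_eq_add_neg, ← smul_sub, sub_sub_sub_cancel_left, ← sub_smul,
    add_sub_cancel_left, smul_smul, inv_mul_cancel₀ hpos, one_smul]
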